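/- For an integer $n\ge 1$ let $\mathcal{A}_{3,n}\subseteq\mathbb{R}^3$ be the Minkowski sum of $n$ copies of the twisted cubic segment $\{(t,t^2,t^3)\mid -1\le t\le 1\}$. For integers $k,\ell\ge 1$ put \begin{align*} A_{k\ell}&=k\ell(k+\ell)^2,\\ B_{k\ell}(x,y)&=2k\ell x\,(2x^2-3(k+\ell)y),\\ C_{k\ell}(x,y)&=x^6-3(k+\ell)x^4y+3(k^2+k\ell+\ell^2)x^2y^2-(k-\ell)^2(k+\ell)y^3,\\ f_{k\ell}(x,y,z)&=A_{k\ell}z^2+B_{k\ell}(x,y)z+C_{k\ell}(x,y). \end{align*} For $n\ge 3$ define $$X=\bigcup_{k=1}^{n-1}\bigl(X_k+(n-k-1)(1,1,1)\bigr),\qquad Y=\bigcup_{\ell=1}^{n-1}\bigl(Y_\ell+(n-\ell-1)(-1,1,-1)\bigr),$$ where $X_k$ is the set of all $(x,y,z)\in\mathbb{R}^3$ such that $$-(k+1)\le x\le k+1,\quad y\le k+(x+k)^2,\quad y\ge \frac{x^2}{k+1},\quad y\le 1+\frac{(x-1)^2}{k},\quad\text{and}\quad z\le\frac{-B_{k1}(x,y)}{2A_{k1}}\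 \text{ or }\ f_{k1}(x,y,z)\le 0,$$ and $Y_\ell$ is the set of all $(x,y,z)\in\mathbb{R}^3$ such that $$-(\ell+1)\le x\le \ell+1,\quad y\le \ell+(x-\ell)^2,\quad y\ge \frac{x^2}{\ell+1},\quad y\le 1+\frac{(x+1)^2}{\ell},\quad\text{and}\quad z\ge\frac{-B_{1\ell}(x,y)}{2A_{1\ell}}\ \text{ or }\ f_{1\ell}(x,y,z)\le 0.$$ Then for every integer $n\ge 3$ we have $\mathcal{A}_{3,n}=X\cap Y$. -/

import Mathlib

open scoped Pointwise

namespace TwistedCubic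

noncomputable section

/-- The twisted cubic segment `{(t, t², t³) | -1 ≤ t ≤ 1}` in `ℝ³`. -/
def segment : Set (Fin 3 → ℝ) :=
  {p | ∃ t : ℝ, -1 ≤ t ∧ t ≤ 1 ∧ p = ![t, t ^ 2, t ^ 3]}

/-- The Minkowski sum of `n` copies of the twisted cubic segment; the sum is the pointwise
(Minkowski) sum of sets. -/
def minkowskiSum (n : ℕ) : Set (Fin 3 → ℝ) :=
  ∑ _i : Fin n, segment

/-- `A_{kℓ} = kℓ(k+ℓ)²`. -/
def A (k l : ℕ) : ℝ := k * l * (k + l) ^ 2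

/-- `B_{kℓ}(x,y) = 2kℓx(2x² - 3(k+ℓ)y)`. -/
def B (k l : ℕ) (x y : ℝ) : ℝ := 2 * k * l * x * (2 * x ^ 2 - 3 * (k + l) * y)

/-- `C_{kℓ}(x,y) = x⁶ - 3(k+ℓ)x⁴y + 3(k²+kℓ+ℓ²)x²y² - (k-ℓ)²(k+ℓ)y³`. -/
def C (k l : ℕ) (x y : ℝ) : ℝ :=
  x ^ 6 - 3 * (k + l) * x ^ 4 * y + 3 * ((k : ℝ) ^ 2 + k * l + (l : ℝ) ^ 2) * x ^ 2 * y ^ 2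
    - ((k : ℝ) - l) ^ 2 * (k + l) * y ^ 3

/-- `f_{kℓ}(x,y,z) = A_{kℓ} z² + B_{kℓ}(x,y) z + C_{kℓ}(x,y)`. -/
def f (k l : ℕ) (x y z : ℝ) : ℝ := A k l * z ^ 2 + B k l x y * z + C k l x y

/-- The `k`-th piece of `X` before translation. -/
def pieceX (k : ℕ) : Set (Fin 3 → ℝ) :=
  {p | ∃ x y z : ℝ, p = ![x, y, z] ∧
    -((k : ℝ) + 1) ≤ x ∧ x ≤ (k : ℝ) + 1 ∧
    y ≤ k + (x + k) ^ 2 ∧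
    y ≥ ((k : ℝ) + 1)⁻¹ * x ^ 2 ∧
    y ≤ 1 + (k : ℝ)⁻¹ * (x - 1) ^ 2 ∧
    (z ≤ -B k 1 x y / (2 * A k 1) ∨ f k 1 x y z ≤ 0)}

/-- The `ℓ`-th piece of `Y` before translation. -/
def pieceY (l : ℕ) : Set (Fin 3 → ℝ) :=
  {p | ∃ x y z : ℝ, p = ![x, y, z] ∧
    -((l : ℝ) + 1) ≤ x ∧ x ≤ (l : ℝ) + 1 ∧
    y ≤ l + (x - l) ^ 2 ∧
    y ≥ ((l : ℝ) + 1)⁻¹ * x ^ 2 ∧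
    y ≤ 1 + (l : ℝ)⁻¹ * (x + 1) ^ 2 ∧
    (z ≥ -B 1 l x y / (2 * A 1 l) ∨ f 1 l x y z ≤ 0)}

/-- `X` is the union over `1 ≤ k ≤ n - 1` of the pieces, translated by `(n-k-1)(1,1,1)`. -/
def X (n : ℕ) : Set (Fin 3 → ℝ) :=
  ⋃ k ∈ Finset.Icc 1 (n - 1),
    (fun p => p + ((n : ℝ) - k - 1) • (![1, 1, 1] : Fin 3 → ℝ)) '' pieceX k

/-- `Y` is the union over `1 ≤ ℓ ≤ n - 1` of the pieces, translated by `(n-ℓ-1)(-1,1,-1)`. -/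
def Y (n : ℕ) : Set (Fin 3 → ℝ) :=
  ⋃ l ∈ Finset.Icc 1 (n - 1),
    (fun p => p + ((n : ℝ) - l - 1) • (![-1, 1, -1] : Fin 3 → ℝ)) '' pieceY l

end

end TwistedCubic

/-!
Write `pⱼ(t) = ∑ᵢ tᵢʲ`. The Minkowski sum consists of the points `(p₁(t), p₂(t), p₃(t))` with
`t ∈ [-1, 1]ⁿ`.

Call `t` *extremal* if no three coordinates satisfy `tᵢ < tⱼ ≤ tₗ < 1`. An extremal `t` has
coordinates `1` (`m` times), `b` (once) and `a` (`k` times), where `a ≤ b` and `m + 1 + k = n`, and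
solving `x = k a + b`, `y = k a² + b²` for `a ≤ b` shows that `X` consists of the points lying
weakly below `(p₁(t), p₂(t), p₃(t))` for some extremal `t` (`mem_X_iff`).

If `t` is not extremal, then three of its coordinates are the roots of a cubic whose constant
coefficient can be lowered slightly while keeping three real roots in `[-1, 1]`. This preserves `p₁`
and `p₂` and raises `p₃` by an arbitrarily small positive amount
(`exists_power_sum_three_between`). So every maximiser of `p₃` on a fibre of `(p₁, p₂)`, or on the
part of a fibre where `p₃ ≤ z` provided that the maximum is less than `z`, is extremal. The first
case shows that the Minkowski sum is contained in `X`, and in `Y` by the reflection `t ↦ -t`.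

For the converse, let `(x, y, z) ∈ X ∩ Y`. Membership in `Y` yields a point of the fibre over
`(x, y)` with `p₃ ≤ z`, so `p₃` has a maximum on the part of the fibre where `p₃ ≤ z`. If this
maximum were less than `z`, it would be attained at an extremal point. But the extremal points over
`(x, y)` all have the same `p₃` (`IsProfile.unique`), and this common value is at least `z` because
`(x, y, z) ∈ X`. Hence the value `z` is attained.
-/

namespace TwistedCubic

/-! ### Moving three coordinates with fixed first two power sums -/

/-- Three distinct zeros of a monic cubic determine its coefficients. -/
lemma vieta_of_three_roots {p q r u v w : ℝ} (huv : u < v) (hvw : v < w)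
    (hu : u ^ 3 - p * u ^ 2 + q * u - r = 0) (hv : v ^ 3 - p * v ^ 2 + q * v - r = 0)
    (hw : w ^ 3 - p * w ^ 2 + q * w - r = 0) :
    p = u + v + w ∧ q = u * v + v * w + w * u ∧ r = u * v * w := by
  have h1 : u ^ 2 + u * v + v ^ 2 - p * (u + v) + q = 0 := by
    have : (v - u) * (u ^ 2 + u * v + v ^ 2 - p * (u + v) + q) = 0 := by linear_combination hv - hu
    exact (mul_eq_zero.mp this).resolve_left (sub_pos.2 huv).ne'
  have h2 : v ^ 2 + v * w + w ^ 2 - p * (v + w) + q = 0 := by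
    have : (w - v) * (v ^ 2 + v * w + w ^ 2 - p * (v + w) + q) = 0 := by linear_combination hw - hv
    exact (mul_eq_zero.mp this).resolve_left (sub_pos.2 hvw).ne'
  have hp : p = u + v + w := by
    have : (w - u) * (u + v + w - p) = 0 := by linear_combination h2 - h1
    have := (mul_eq_zero.mp this).resolve_left (sub_pos.2 (huv.trans hvw)).ne'
    linarith
  subst hp
  have hq : q = u * v + v * w + w * u := by linear_combination h1
  subst hq
  exact ⟨rfl, rfl, by linear_combination -hu⟩

/-- The new values are the roots of `(T - u) (T - v) (T - w) - ε` for a small `ε > 0`. -/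
lemma exists_three_cube_sum_between {u v w δ : ℝ} (hu : -1 ≤ u) (huv : u < v) (hvw : v ≤ w)
    (hw : w < 1) (hδ : 0 < δ) :
    ∃ u' v' w' : ℝ, u' ∈ Set.Icc (-1) 1 ∧ v' ∈ Set.Icc (-1) 1 ∧ w' ∈ Set.Icc (-1) 1 ∧
      u' + v' + w' = u + v + w ∧ u' ^ 2 + v' ^ 2 + w' ^ 2 = u ^ 2 + v ^ 2 + w ^ 2 ∧
      u ^ 3 + v ^ 3 + w ^ 3 < u' ^ 3 + v' ^ 3 + w' ^ 3 ∧
      u' ^ 3 + v' ^ 3 + w' ^ 3 < u ^ 3 + v ^ 3 + w ^ 3 + δ := by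
  set c : ℝ := (u + v) / 2 with hc
  have huc : u < c := by linarith
  have hcv : c < v := by linarith
  have hc0 : 0 < (c - u) * (c - v) * (c - w) :=
    mul_pos_of_neg_of_neg (mul_neg_of_pos_of_neg (by linarith) (by linarith)) (by linarith)
  have h10 : 0 < (1 - u) * (1 - v) * (1 - w) :=
    mul_pos (mul_pos (by linarith) (by linarith)) (by linarith)
  obtain ⟨ε, hε, hε'⟩ : ∃ ε : ℝ, 0 < ε ∧
      ε < min (min ((c - u) * (c - v) * (c - w)) ((1 - u) * (1 - v) * (1 - w))) (δ / 3) :=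
    exists_between (lt_min (lt_min hc0 h10) (by positivity))
  rw [lt_min_iff, lt_min_iff] at hε'
  obtain ⟨⟨hεc, hε1⟩, hεδ⟩ := hε'
  set g : ℝ → ℝ := fun T ↦ (T - u) * (T - v) * (T - w) - ε with hg
  have hgc : Continuous g := by fun_prop
  have gu : g u < 0 := by simp [hg, hε]
  have gv : g v < 0 := by simp [hg, hε]
  have gc : 0 < g c := by simp only [hg]; linarith
  have g1 : 0 < g 1 := by simp only [hg]; linarith
  obtain ⟨u', hu', eu⟩ := intermediate_value_Ioo huc.le hgc.continuousOn ⟨gu, gc⟩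
  obtain ⟨v', hv', ev⟩ := intermediate_value_Ioo' hcv.le hgc.continuousOn ⟨gv, gc⟩
  obtain ⟨w', hw', ew⟩ := intermediate_value_Ioo (by linarith : v ≤ 1) hgc.continuousOn ⟨gv, g1⟩
  simp only [hg] at eu ev ew
  obtain ⟨h1, h2, h3⟩ := vieta_of_three_roots (p := u + v + w) (q := u * v + v * w + w * u)
    (r := u * v * w + ε) (hu'.2.trans hv'.1) (hv'.2.trans hw'.1)
    (by linear_combination eu) (by linear_combination ev) (by linear_combination ew)
  have key : u' ^ 3 + v' ^ 3 + w' ^ 3 = u ^ 3 + v ^ 3 + w ^ 3 + 3 * ε := by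
    -- Newton's identity `p₃ = e₁³ - 3 e₁ e₂ + 3 e₃`
    have e : ∀ α β γ : ℝ, α ^ 3 + β ^ 3 + γ ^ 3 = (α + β + γ) ^ 3
        - 3 * (α + β + γ) * (α * β + β * γ + γ * α) + 3 * (α * β * γ) := by intros; ring
    rw [e u', e u, ← h1, ← h2, ← h3]; ring
  refine ⟨u', v', w', ⟨by linarith [hu'.1], by linarith [hu'.2]⟩,
    ⟨by linarith [hv'.1], by linarith [hv'.2]⟩, ⟨by linarith [hw'.1], by linarith [hw'.2]⟩,
    h1.symm, ?_, by linarith, by linarith⟩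
  linear_combination -(u + v + w + u' + v' + w') * h1 + 2 * h2

/-- Effect on `∑ g (t i)` of changing the values of `t` at three indices. -/
lemma sum_comp_update_three {ι : Type*} [Fintype ι] [DecidableEq ι] (t : ι → ℝ) {i j l : ι}
    (hij : i ≠ j) (hil : i ≠ l) (hjl : j ≠ l) (u v w : ℝ) (g : ℝ → ℝ) :
    ∑ x, g (Function.update (Function.update (Function.update t i u) j v) l w x) =
      ∑ x, g (t x) + (g u + g v + g w - (g (t i) + g (t j) + g (t l))) := by
  have h : ∀ x, g (Function.update (Function.update (Function.update t i u) j v) l w x) =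
      g (t x) + ((if x = i then g u - g (t i) else 0) + (if x = j then g v - g (t j) else 0)
        + (if x = l then g w - g (t l) else 0)) := by
    intro x
    by_cases hl : x = l
    · subst hl; simp [hil.symm, hjl.symm]
    by_cases hj : x = j
    · subst hj; simp [hl, hij.symm]
    by_cases hi : x = i
    · subst hi; simp [hl, hj]
    simp [hl, hj, hi]
  simp only [h, Finset.sum_add_distrib, Finset.sum_ite_eq', Finset.mem_univ, if_true]
  ring

/-- The power sums of a non-extremal point of the cube admit a small increase of the third one. -/
lemma exists_power_sum_three_between {ι : Type*} [Fintype ι] {t : ι → ℝ}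
    (ht : ∀ i, t i ∈ Set.Icc (-1) 1) {i j l : ι} (hij : t i < t j) (hjl : t j ≤ t l)
    (hne : j ≠ l) (hl : t l < 1) {δ : ℝ} (hδ : 0 < δ) :
    ∃ t' : ι → ℝ, (∀ i, t' i ∈ Set.Icc (-1) 1) ∧ ∑ i, t' i = ∑ i, t i ∧
      ∑ i, t' i ^ 2 = ∑ i, t i ^ 2 ∧ ∑ i, t i ^ 3 < ∑ i, t' i ^ 3 ∧
      ∑ i, t' i ^ 3 < ∑ i, t i ^ 3 + δ := by
  classical
  obtain ⟨u, v, w, hu, hv, hw, h1, h2, h3, h4⟩ :=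
    exists_three_cube_sum_between (ht i).1 hij hjl hl hδ
  have h12 : i ≠ j := by rintro rfl; exact hij.false
  have h13 : i ≠ l := by rintro rfl; exact (hij.trans_le hjl).false
  refine ⟨Function.update (Function.update (Function.update t i u) j v) l w, ?_, ?_, ?_, ?_, ?_⟩
  · intro x
    simp only [Function.update_apply]
    split_ifs
    exacts [hw, hv, hu, ht x]
  · rw [sum_comp_update_three t h12 h13 hne u v w (fun x ↦ x)]; linarith
  · rw [sum_comp_update_three t h12 h13 hne u v w (fun x ↦ x ^ 2)]; linarith
  · rw [sum_comp_update_three t h12 h13 hne u v w (fun x ↦ x ^ 3)]; linarith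
  · rw [sum_comp_update_three t h12 h13 hne u v w (fun x ↦ x ^ 3)]; linarith

/-! ### Extremal points of the cube -/

/-- `(x, y, z)` is the vector of the first three power sums of an extremal point of `[-1, 1]ⁿ`:
one with `m` coordinates `1`, one coordinate `b` and `k ≥ 1` coordinates `a`, where `a ≤ b`. -/
def IsProfile (n : ℕ) (x y z : ℝ) : Prop :=
  ∃ (m k : ℕ) (a b : ℝ), 1 ≤ k ∧ m + 1 + k = n ∧ -1 ≤ a ∧ a ≤ b ∧ b ≤ 1 ∧
    x = m + b + k * a ∧ y = m + b ^ 2 + k * a ^ 2 ∧ z = m + b ^ 3 + k * a ^ 3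

lemma IsProfile.exists_point {n : ℕ} {x y z : ℝ} (h : IsProfile n x y z) :
    ∃ t : Fin n → ℝ, (∀ i, t i ∈ Set.Icc (-1) 1) ∧ ∑ i, t i = x ∧ ∑ i, t i ^ 2 = y ∧
      ∑ i, t i ^ 3 = z := by
  obtain ⟨m, k, a, b, -, rfl, ha, hab, hb, rfl, rfl, rfl⟩ := h
  set s : ℕ → ℝ := fun i ↦ if i < m then 1 else if i = m then b else a with hs
  have key : ∀ g : ℝ → ℝ, ∑ i : Fin (m + 1 + k), g (s i) = m * g 1 + g b + k * g a := by
    intro g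
    rw [Fin.sum_univ_eq_sum_range (fun i ↦ g (s i)), Finset.sum_range_add,
      Finset.sum_range_succ]
    have e1 : ∑ i ∈ Finset.range m, g (s i) = ∑ i ∈ Finset.range m, g 1 :=
      Finset.sum_congr rfl fun i hi ↦ by simp [hs, Finset.mem_range.1 hi]
    have e2 : ∀ i, s (m + 1 + i) = a := fun i ↦ by
      have h1 : ¬ m + 1 + i < m := by omega
      have h2 : ¬ m + 1 + i = m := by omega
      simp only [hs, h1, h2, if_false]
    rw [e1]
    simp only [e2]
    simp [hs]
  refine ⟨fun i ↦ s i, fun i ↦ ?_, ?_, ?_, ?_⟩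
  · simp only [hs]
    split_ifs
    exacts [⟨by norm_num, le_rfl⟩, ⟨by linarith, hb⟩, ⟨ha, by linarith⟩]
  · simpa using key fun x ↦ x
  · simpa using key fun x ↦ x ^ (2 : ℕ)
  · simpa using key fun x ↦ x ^ (3 : ℕ)

lemma isProfile_of_extremal {n : ℕ} (hn : 2 ≤ n) {t : Fin n → ℝ}
    (ht : ∀ i, t i ∈ Set.Icc (-1) 1)
    (hext : ∀ i j l, j ≠ l → t i < t j → t j ≤ t l → ¬ t l < 1) :
    IsProfile n (∑ i, t i) (∑ i, t i ^ 2) (∑ i, t i ^ 3) := by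
  classical
  -- `S` is a set of at least two indices outside of which all coordinates are `1`; it has exactly two
  -- elements unless all its coordinates are less than `1`.
  obtain ⟨S, hS2, hS1, hS⟩ : ∃ S : Finset (Fin n), 2 ≤ S.card ∧ (∀ i ∉ S, t i = 1) ∧
      (S.card = 2 ∨ ∀ i ∈ S, t i < 1) := by
    set S₀ : Finset (Fin n) := Finset.univ.filter fun i ↦ t i < 1 with hS₀
    have h1 : ∀ i ∉ S₀, t i = 1 := fun i hi ↦
      le_antisymm (ht i).2 (by simpa [hS₀] using hi)
    by_cases h : 2 ≤ S₀.card
    · exact ⟨S₀, h, h1, Or.inr fun i hi ↦ by simpa [hS₀] using hi⟩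
    · obtain ⟨S, hsub, hcard⟩ := Finset.exists_superset_card_eq (s := S₀) (n := 2) (by omega)
        (by simpa using hn)
      exact ⟨S, hcard.ge, fun i hi ↦ h1 i fun h' ↦ hi (hsub h'), Or.inl hcard⟩
  obtain ⟨i₀, hi₀, hmax⟩ := S.exists_max_image t (Finset.card_pos.1 (by omega))
  have hcard : (S.erase i₀).card = S.card - 1 := Finset.card_erase_of_mem hi₀
  obtain ⟨i₁, hi₁⟩ := Finset.card_pos.1 (by omega : 0 < (S.erase i₀).card)
  have hconst : ∀ j ∈ S.erase i₀, t j = t i₁ := by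
    rcases hS with h | h
    · intro j hj
      rw [Finset.card_le_one.1 (by omega : (S.erase i₀).card ≤ 1) j hj i₁ hi₁]
    · have : ∀ j ∈ S.erase i₀, ∀ l ∈ S.erase i₀, t j ≤ t l := by
        intro j hj l hl
        by_contra! hlt
        rw [Finset.mem_erase] at hj hl
        exact hext l j i₀ hj.1 hlt (hmax j hj.2) (h i₀ hi₀)
      exact fun j hj ↦ le_antisymm (this j hj i₁ hi₁) (this i₁ hi₁ j hj)
  have hsum : ∀ g : ℝ → ℝ, ∑ i, g (t i) =
      (n - S.card : ℕ) * g 1 + g (t i₀) + (S.card - 1 : ℕ) * g (t i₁) := by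
    intro g
    rw [← Finset.sum_add_sum_compl S, ← Finset.add_sum_erase S _ hi₀,
      Finset.sum_congr rfl fun j hj ↦ by rw [hconst j hj],
      Finset.sum_congr (rfl : Sᶜ = Sᶜ) fun j hj ↦ by rw [hS1 j (Finset.mem_compl.1 hj)],
      Finset.sum_const, Finset.sum_const, hcard, Finset.card_compl, Fintype.card_fin,
      nsmul_eq_mul, nsmul_eq_mul]
    ring
  have hle : S.card ≤ n := by simpa using S.card_le_univ
  exact ⟨n - S.card, S.card - 1, t i₁, t i₀, by omega, by omega, (ht i₁).1,
    hmax i₁ (Finset.mem_of_mem_erase hi₁), (ht i₀).2, by simpa using hsum fun x ↦ x,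
    by simpa using hsum fun x ↦ x ^ (2 : ℕ), by simpa using hsum fun x ↦ x ^ (3 : ℕ)⟩

/-- Uniqueness of profiles when one has at least as many ones as the other. The value `b` is the
largest coordinate possible for the given first two power sums, so `b = 1` if the second profile has
an additional one; equality in the Cauchy–Schwarz inequality then determines that profile. -/
lemma profile_unique_aux {m k m' k' : ℕ} {a b a' b' : ℝ} (hk : 1 ≤ k) (hk' : 1 ≤ k')
    (hmk : m + 1 + k = m' + 1 + k') (hab : a ≤ b) (hb : b ≤ 1) (hab' : a' ≤ b')
    (hm : m ≤ m') (h1 : (m : ℝ) + b + k * a = m' + b' + k' * a')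
    (h2 : (m : ℝ) + b ^ 2 + k * a ^ 2 = m' + b' ^ 2 + k' * a' ^ 2) :
    (m : ℝ) + b ^ 3 + k * a ^ 3 = m' + b' ^ 3 + k' * a' ^ 3 := by
  have hk0 : (1 : ℝ) ≤ k := by exact_mod_cast hk
  have hk0' : (1 : ℝ) ≤ k' := by exact_mod_cast hk'
  rcases hm.eq_or_lt with rfl | hlt
  · have hkk : k = k' := by omega
    subst hkk
    have e1 : b - b' = k * (a' - a) := by linarith
    -- subtracting the two equations factors out `a' - a`
    have e2 : (a' - a) * ((b - a) + (b' - a')) = 0 := by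
      have : (k : ℝ) * ((a' - a) * ((b - a) + (b' - a'))) = 0 := by
        linear_combination h2 - (b + b') * e1
      exact (mul_eq_zero.mp this).resolve_left (by positivity)
    have ha : a' = a := by
      rcases mul_eq_zero.mp e2 with h | h
      · linarith
      · have h3 : b = a := by linarith
        have h4 : b' = a' := by linarith
        have : ((k : ℝ) + 1) * (a' - a) = 0 := by rw [h3, h4] at e1; linarith
        have := (mul_eq_zero.mp this).resolve_left (by positivity)
        linarith
    subst ha
    have : b = b' := by linarith
    rw [this]
  · obtain ⟨j, rfl⟩ := Nat.exists_eq_add_of_lt hlt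
    obtain rfl : k = j + 1 + k' := by omega
    push_cast at *
    have hj : (0 : ℝ) ≤ j := j.cast_nonneg
    set K : ℝ := j + 1 + k' with hK
    -- Besides the `m + 1` ones, the second profile has the coordinates `1` (`j` times), `b'` (once)
    -- and `a'` (`k'` times). The left side is `K²` times the variance of these `K` numbers.
    have hV : j * (1 - b') ^ 2 + j * k' * (1 - a') ^ 2 + k' * (b' - a') ^ 2 =
        -((1 - b) * (K * (b + 1 - 2 * a) + (1 - b))) := by
      have e1 : j + b' + k' * a' = b + K * a - 1 := by linarith
      have e2 : j + b' ^ 2 + k' * a' ^ 2 = b ^ 2 + K * a ^ 2 - 1 := by linarith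
      calc _ = K * (j + b' ^ 2 + k' * a' ^ 2) - (j + b' + k' * a') ^ 2 := by rw [hK]; ring
        _ = _ := by rw [e1, e2]; ring
    have n1 : 0 ≤ j * (1 - b') ^ 2 := by positivity
    have n2 : 0 ≤ j * k' * (1 - a') ^ 2 := by positivity
    have n3 : 0 ≤ k' * (b' - a') ^ 2 := by positivity
    have n4 : 0 ≤ (1 - b) * (K * (b + 1 - 2 * a)) :=
      mul_nonneg (by linarith) (mul_nonneg (by linarith) (by linarith))
    have hb1 : b = 1 := by
      have : (1 - b) ^ 2 ≤ 0 := by linarith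
      have := pow_eq_zero_iff (two_ne_zero) |>.1 (le_antisymm this (sq_nonneg _))
      linarith
    subst hb1
    have hba : b' = a' := by
      have : k' * (b' - a') ^ 2 = 0 := by linarith
      have := pow_eq_zero_iff (two_ne_zero) |>.1
        ((mul_eq_zero.1 this).resolve_left (by positivity))
      linarith
    subst hba
    have hj' : (j : ℝ) * (1 - b') ^ 2 = 0 := by linarith
    rcases mul_eq_zero.1 hj' with h | h
    · have : ((k' : ℝ) + 1) * (b' - a) = 0 := by rw [hK, h] at h1; linarith
      have := (mul_eq_zero.1 this).resolve_left (by positivity)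
      obtain rfl : b' = a := by linarith
      rw [hK, h]; ring
    · obtain rfl : b' = 1 := by linarith [pow_eq_zero_iff (two_ne_zero) |>.1 h]
      have : K * (1 - a) = 0 := by linarith
      have := (mul_eq_zero.1 this).resolve_left (by linarith)
      obtain rfl : a = 1 := by linarith
      rw [hK]; ring

lemma IsProfile.unique {n : ℕ} {x y z z' : ℝ} (h : IsProfile n x y z) (h' : IsProfile n x y z') :
    z = z' := by
  obtain ⟨m, k, a, b, hk, rfl, -, hab, hb, rfl, rfl, rfl⟩ := h
  obtain ⟨m', k', a', b', hk', hn, -, hab', hb', h1, h2, rfl⟩ := h'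
  rcases le_total m m' with hm | hm
  · exact profile_unique_aux hk hk' hn.symm hab hb hab' hm h1 h2
  · exact (profile_unique_aux hk' hk hn hab' hb' hab hm h1.symm h2.symm).symm

/-! ### Maximising `p₃` on a fibre of `(p₁, p₂)` -/

/-- The point `t'` maximises `p₃` on the compact part of the fibre of `(p₁, p₂)` through `t` where
`p₃ ≤ z`. If the maximum is less than `z`, then `t'` is extremal, as `p₃` could otherwise be raised
without exceeding `z`. -/
lemma exists_point_eq_or_isProfile {n : ℕ} (hn : 2 ≤ n) {z : ℝ} {t : Fin n → ℝ}
    (ht : ∀ i, t i ∈ Set.Icc (-1) 1) (hz : ∑ i, t i ^ 3 ≤ z) :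
    ∃ t' : Fin n → ℝ, (∀ i, t' i ∈ Set.Icc (-1) 1) ∧ ∑ i, t' i = ∑ i, t i ∧
      ∑ i, t' i ^ 2 = ∑ i, t i ^ 2 ∧ ∑ i, t i ^ 3 ≤ ∑ i, t' i ^ 3 ∧
      (∑ i, t' i ^ 3 = z ∨ ∑ i, t' i ^ 3 < z ∧
        IsProfile n (∑ i, t i) (∑ i, t i ^ 2) (∑ i, t' i ^ 3)) := by
  set F : Set (Fin n → ℝ) := Set.Icc (-1) 1 ∩ {s | ∑ i, s i = ∑ i, t i ∧
    ∑ i, s i ^ 2 = ∑ i, t i ^ 2 ∧ ∑ i, s i ^ 3 ≤ z} with hF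
  have hmem : ∀ s : Fin n → ℝ, s ∈ Set.Icc (-1) 1 ↔ ∀ i, s i ∈ Set.Icc (-1 : ℝ) 1 := fun s ↦ by
    simp [Set.mem_Icc, Pi.le_def, forall_and]
  have hFc : IsCompact F := by
    refine isCompact_Icc.inter_right ?_
    simp only [Set.ofPred_and]
    exact (isClosed_eq (by fun_prop) (by fun_prop)).inter
      ((isClosed_eq (by fun_prop) (by fun_prop)).inter (isClosed_le (by fun_prop) (by fun_prop)))
  obtain ⟨s, hs, hmax⟩ := hFc.exists_isMaxOn ⟨t, (hmem t).2 ht, rfl, rfl, hz⟩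
    (f := fun s ↦ ∑ i, s i ^ 3) (by fun_prop)
  obtain ⟨hs0, hs1, hs2, hs3⟩ := hs
  rw [hmem] at hs0
  refine ⟨s, hs0, hs1, hs2, hmax ⟨(hmem t).2 ht, rfl, rfl, hz⟩, ?_⟩
  rcases hs3.eq_or_lt with h | hlt
  · exact Or.inl h
  refine Or.inr ⟨hlt, ?_⟩
  rw [← hs1, ← hs2]
  refine isProfile_of_extremal hn hs0 fun i j l hjl h1 h2 h3 ↦ ?_
  obtain ⟨s', hs0', hs1', hs2', hs3', hs4'⟩ :=
    exists_power_sum_three_between hs0 h1 h2 hjl h3 (sub_pos.2 hlt)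
  have : ∑ i, s' i ^ 3 ≤ ∑ i, s i ^ 3 :=
    hmax ⟨(hmem s').2 hs0', hs1'.trans hs1, hs2'.trans hs2, by linarith⟩
  linarith

/-- Every fibre of `(p₁, p₂)` in the cube lies below a profile. -/
lemma exists_isProfile_ge {n : ℕ} (hn : 2 ≤ n) {t : Fin n → ℝ}
    (ht : ∀ i, t i ∈ Set.Icc (-1) 1) :
    ∃ z, ∑ i, t i ^ 3 ≤ z ∧ IsProfile n (∑ i, t i) (∑ i, t i ^ 2) z := by
  have hle : ∀ s : Fin n → ℝ, (∀ i, s i ∈ Set.Icc (-1) 1) → ∑ i, s i ^ 3 ≤ n := fun s hs ↦ by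
    calc ∑ i, s i ^ 3 ≤ ∑ _i : Fin n, (1 : ℝ) :=
          Finset.sum_le_sum fun i _ ↦ by
            have := hs i
            nlinarith [this.1, this.2, sq_nonneg (s i + 1), sq_nonneg (s i)]
      _ = n := by simp
  obtain ⟨t', h0, -, -, h3, h4⟩ := exists_point_eq_or_isProfile hn ht
    (z := n + 1) (by linarith [hle t ht])
  rcases h4 with h4 | h4
  · linarith [hle t' h0]
  · exact ⟨_, h3, h4.2⟩

/-! ### The sets `X` and `Y` in terms of profiles -/

/-- The inequalities on `(x, y)` in `pieceX k` say that the solution of `x = b + k a`,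
`y = b² + k a²` with `a ≤ b` exists and has `-1 ≤ a` and `b ≤ 1`; the condition on `z` says that `z`
is at most the larger zero of `f`. -/
lemma mem_pieceX_iff {k : ℕ} (hk : 1 ≤ k) {x y z : ℝ} :
    ![x, y, z] ∈ pieceX k ↔ ∃ a b : ℝ, -1 ≤ a ∧ a ≤ b ∧ b ≤ 1 ∧ x = b + k * a ∧
      y = b ^ 2 + k * a ^ 2 ∧ z ≤ b ^ 3 + k * a ^ 3 := by
  have hk0 : (1 : ℝ) ≤ k := by exact_mod_cast hk
  have hk1 : (k : ℝ) ≠ 0 := by positivity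
  have hk2 : (k : ℝ) + 1 ≠ 0 := by positivity
  -- In terms of `M = x / (k + 1)` and `s = (b - a) / (k + 1)`, we have `a = M - s` and
  -- `b = M + k s`. The zeros of the quadratic `f` in `z` are `b³ + k a³` and its value for `-s`.
  have hz : ∀ M s z : ℝ, 0 ≤ s → ((z ≤ -B k 1 ((k + 1) * M) ((k + 1) * M ^ 2 + k * (k + 1) * s ^ 2)
        / (2 * A k 1) ∨ f k 1 ((k + 1) * M) ((k + 1) * M ^ 2 + k * (k + 1) * s ^ 2) z ≤ 0) ↔
      z ≤ (M + k * s) ^ 3 + k * (M - s) ^ 3) := by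
    intro M s z hs
    set c : ℝ := (k + 1) * M ^ 3 + 3 * k * (k + 1) * M * s ^ 2 with hc
    set d : ℝ := k * (k + 1) * (k - 1) * s ^ 3 with hd
    have hd0 : 0 ≤ d := by
      have : (0 : ℝ) ≤ k - 1 := by linarith
      positivity
    have e1 : -B k 1 ((k + 1) * M) ((k + 1) * M ^ 2 + k * (k + 1) * s ^ 2) / (2 * A k 1) = c := by
      simp only [A, B, hc]; push_cast; field_simp; ring
    have e2 : f k 1 ((k + 1) * M) ((k + 1) * M ^ 2 + k * (k + 1) * s ^ 2) z =
        k * (k + 1) ^ 2 * ((z - c) ^ 2 - d ^ 2) := by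
      simp only [f, A, B, C, hc, hd]; push_cast; ring
    have e3 : (M + k * s) ^ 3 + k * (M - s) ^ 3 = c + d := by simp only [hc, hd]; ring
    have hpos : (0 : ℝ) < k * (k + 1) ^ 2 := by positivity
    rw [e1, e2, e3]
    constructor
    · rintro (h | h)
      · linarith
      · have h' : (z - c) ^ 2 ≤ d ^ 2 := by
          by_contra! hlt
          linarith [mul_pos hpos (sub_pos.2 hlt)]
        linarith [(abs_le.1 (abs_le_of_sq_le_sq h' hd0)).2]
    · intro h
      rcases le_or_gt z c with hzc | hzc
      · exact Or.inl hzc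
      · have : (z - c) ^ 2 ≤ d ^ 2 := pow_le_pow_left₀ (by linarith) (by linarith) 2
        exact Or.inr (mul_nonpos_of_nonneg_of_nonpos hpos.le (by linarith))
  constructor
  · rintro ⟨x', y', z', hp, hx1, hx2, hy1, hy2, hy3, h⟩
    obtain ⟨rfl, rfl, rfl⟩ : x = x' ∧ y = y' ∧ z = z' :=
      ⟨congrFun hp 0, congrFun hp 1, congrFun hp 2⟩
    obtain ⟨M, rfl⟩ : ∃ M, x = (k + 1) * M := ⟨x / (k + 1), by field_simp⟩
    have hM1 : -1 ≤ M := by nlinarith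
    have hM2 : M ≤ 1 := by nlinarith
    have e : ((k : ℝ) + 1)⁻¹ * ((k + 1) * M) ^ 2 = (k + 1) * M ^ 2 := by field_simp
    rw [e] at hy2
    obtain ⟨s, hs, rfl⟩ : ∃ s, 0 ≤ s ∧ y = (k + 1) * M ^ 2 + k * (k + 1) * s ^ 2 := by
      refine ⟨√((y - (k + 1) * M ^ 2) / (k * (k + 1))), Real.sqrt_nonneg _, ?_⟩
      rw [Real.sq_sqrt (div_nonneg (by linarith) (by positivity))]
      field_simp
      ring
    have hkk : (0 : ℝ) < k * (k + 1) := by positivity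
    -- `-1 ≤ a`, from `y ≤ k + (x + k)²`
    have hs1 : s ≤ M + 1 := by
      refine le_of_abs_le (abs_le_of_sq_le_sq ?_ (by linarith))
      refine le_of_mul_le_mul_left ?_ hkk
      linarith
    -- `b ≤ 1`, from `y ≤ 1 + (x - 1)² / k`
    have hs2 : k * s ≤ 1 - M := by
      refine le_of_abs_le (abs_le_of_sq_le_sq ?_ (by linarith))
      have e : 1 + (k : ℝ)⁻¹ * ((k + 1) * M - 1) ^ 2 =
          (k + 1) * M ^ 2 + (k : ℝ)⁻¹ * ((k + 1) * (1 - M) ^ 2) := by field_simp; ring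
      rw [e, add_le_add_iff_left, le_inv_mul_iff₀ (by positivity)] at hy3
      refine le_of_mul_le_mul_left ?_ (by positivity : (0 : ℝ) < k + 1)
      linarith
    have hks : 0 ≤ k * s := by positivity
    exact ⟨M - s, M + k * s, by linarith, by linarith, by linarith, by ring, by ring,
      (hz M s z hs).1 h⟩
  · rintro ⟨a, b, ha, hab, hb, rfl, rfl, h⟩
    obtain ⟨M, s, rfl, rfl⟩ : ∃ M s, a = M - s ∧ b = M + k * s :=
      ⟨(b + k * a) / (k + 1), (b - a) / (k + 1), by field_simp; ring, by field_simp; ring⟩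
    have hs : 0 ≤ s := by
      by_contra! hs
      nlinarith
    have e1 : M + k * s + k * (M - s) = (k + 1) * M := by ring
    have e2 : (M + k * s) ^ 2 + k * (M - s) ^ 2 = (k + 1) * M ^ 2 + k * (k + 1) * s ^ 2 := by ring
    have hks : 0 ≤ k * s := by positivity
    have hkk : (0 : ℝ) < k * (k + 1) := by positivity
    rw [e1, e2]
    refine ⟨_, _, _, rfl, by nlinarith, by nlinarith, ?_, ?_, ?_, (hz M s z hs).2 h⟩
    · have : s ^ 2 ≤ (M + 1) ^ 2 := pow_le_pow_left₀ hs (by linarith) 2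
      linarith [mul_le_mul_of_nonneg_left this hkk.le]
    · have e : ((k : ℝ) + 1)⁻¹ * ((k + 1) * M) ^ 2 = (k + 1) * M ^ 2 := by field_simp
      rw [e]
      have : 0 ≤ k * (k + 1) * s ^ 2 := by positivity
      linarith
    · have e : 1 + (k : ℝ)⁻¹ * ((k + 1) * M - 1) ^ 2 =
          (k + 1) * M ^ 2 + (k : ℝ)⁻¹ * ((k + 1) * (1 - M) ^ 2) := by field_simp; ring
      rw [e, add_le_add_iff_left, le_inv_mul_iff₀ (by positivity)]
      have : (k * s) ^ 2 ≤ (1 - M) ^ 2 := pow_le_pow_left₀ hks (by linarith) 2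
      linarith [mul_le_mul_of_nonneg_left this (by positivity : (0 : ℝ) ≤ k + 1)]

lemma mem_X_iff {n : ℕ} {x y z : ℝ} :
    ![x, y, z] ∈ X n ↔ ∃ z', z ≤ z' ∧ IsProfile n x y z' := by
  simp only [X, Set.mem_iUnion, Finset.mem_Icc, Set.mem_image, exists_prop]
  constructor
  · rintro ⟨k, ⟨hk, hkn⟩, p, hp, hpe⟩
    obtain ⟨m, rfl⟩ : ∃ m, n = m + 1 + k := ⟨n - 1 - k, by omega⟩
    have hp' := hp
    obtain ⟨x', y', z', rfl, -⟩ := hp'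
    obtain ⟨a, b, ha, hab, hb, rfl, rfl, hz⟩ := (mem_pieceX_iff hk).1 hp
    have h0 := congrFun hpe 0
    have h1 := congrFun hpe 1
    have h2 := congrFun hpe 2
    simp at h0 h1 h2
    exact ⟨m + b ^ 3 + k * a ^ 3, by linarith, m, k, a, b, hk, rfl, ha, hab, hb, by linarith,
      by linarith, rfl⟩
  · rintro ⟨_, hz, m, k, a, b, hk, rfl, ha, hab, hb, rfl, rfl, rfl⟩
    refine ⟨k, ⟨hk, by omega⟩, ![b + k * a, b ^ 2 + k * a ^ 2, z - m],
      (mem_pieceX_iff hk).2 ⟨a, b, ha, hab, hb, rfl, rfl, by linarith⟩, ?_⟩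
    ext i
    fin_cases i <;> simp <;> ring

lemma mem_pieceY_iff_mem_pieceX {l : ℕ} {x y z : ℝ} :
    ![x, y, z] ∈ pieceY l ↔ ![-x, y, -z] ∈ pieceX l := by
  have hB : -B l 1 (-x) y / (2 * A l 1) = -(-B 1 l x y / (2 * A 1 l)) := by
    simp only [A, B]; push_cast; ring
  have hf : f l 1 (-x) y (-z) = f 1 l x y z := by
    simp only [f, A, B, C]; push_cast; ring
  have hq1 : (-x + l) ^ 2 = (x - l) ^ 2 := by ring
  have hq2 : (-x - 1) ^ 2 = (x + 1) ^ 2 := by ring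
  have hX : ![-x, y, -z] ∈ pieceX l ↔ -((l : ℝ) + 1) ≤ -x ∧ -x ≤ (l : ℝ) + 1 ∧
      y ≤ l + (-x + l) ^ 2 ∧ y ≥ ((l : ℝ) + 1)⁻¹ * (-x) ^ 2 ∧
      y ≤ 1 + (l : ℝ)⁻¹ * (-x - 1) ^ 2 ∧
      (-z ≤ -B l 1 (-x) y / (2 * A l 1) ∨ f l 1 (-x) y (-z) ≤ 0) := by
    refine ⟨?_, fun h ↦ ⟨_, _, _, rfl, h⟩⟩
    rintro ⟨x', y', z', hp, h⟩
    obtain ⟨rfl, rfl, rfl⟩ : -x = x' ∧ y = y' ∧ -z = z' :=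
      ⟨congrFun hp 0, congrFun hp 1, congrFun hp 2⟩
    exact h
  rw [hX, hB, hf, hq1, hq2, neg_sq, neg_le_neg_iff, neg_le_neg_iff, neg_le]
  constructor
  · rintro ⟨x', y', z', hp, h1, h2, h⟩
    obtain ⟨rfl, rfl, rfl⟩ : x = x' ∧ y = y' ∧ z = z' :=
      ⟨congrFun hp 0, congrFun hp 1, congrFun hp 2⟩
    exact ⟨h2, h1, h⟩
  · rintro ⟨h1, h2, h⟩
    exact ⟨x, y, z, rfl, h2, h1, h⟩

lemma mem_Y_iff_mem_X {n : ℕ} {x y z : ℝ} : ![x, y, z] ∈ Y n ↔ ![-x, y, -z] ∈ X n := by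
  simp only [X, Y, Set.mem_iUnion, Finset.mem_Icc, Set.mem_image, exists_prop]
  refine exists_congr fun l ↦ and_congr_right fun _ ↦ ?_
  constructor
  · rintro ⟨p, hp, hpe⟩
    have hp' := hp
    obtain ⟨x', y', z', rfl, -⟩ := hp'
    refine ⟨_, mem_pieceY_iff_mem_pieceX.1 hp, ?_⟩
    have h0 := congrFun hpe 0
    have h1 := congrFun hpe 1
    have h2 := congrFun hpe 2
    simp at h0 h1 h2
    ext i
    fin_cases i <;> simp <;> linarith
  · rintro ⟨p, hp, hpe⟩
    have hp' := hp
    obtain ⟨x', y', z', rfl, -⟩ := hp'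
    refine ⟨![-x', y', -z'], mem_pieceY_iff_mem_pieceX.2 (by simpa using hp), ?_⟩
    have h0 := congrFun hpe 0
    have h1 := congrFun hpe 1
    have h2 := congrFun hpe 2
    simp at h0 h1 h2
    ext i
    fin_cases i <;> simp <;> linarith

/-! ### The Minkowski sum -/

lemma mem_minkowskiSum_iff {n : ℕ} {x y z : ℝ} :
    ![x, y, z] ∈ minkowskiSum n ↔ ∃ t : Fin n → ℝ, (∀ i, t i ∈ Set.Icc (-1) 1) ∧
      ∑ i, t i = x ∧ ∑ i, t i ^ 2 = y ∧ ∑ i, t i ^ 3 = z := by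
  rw [minkowskiSum, Set.mem_fintype_sum]
  constructor
  · rintro ⟨g, hg, hsum⟩
    choose t h1 h2 h3 using hg
    refine ⟨t, fun i ↦ ⟨h1 i, h2 i⟩, ?_, ?_, ?_⟩
    · simpa [h3] using congrFun hsum 0
    · simpa [h3] using congrFun hsum 1
    · simpa [h3] using congrFun hsum 2
  · rintro ⟨t, ht, rfl, rfl, rfl⟩
    refine ⟨fun i ↦ ![t i, t i ^ 2, t i ^ 3], fun i ↦ ⟨t i, (ht i).1, (ht i).2, rfl⟩, ?_⟩
    ext j
    fin_cases j <;> simp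

lemma neg_mem_minkowskiSum {n : ℕ} {x y z : ℝ} (h : ![x, y, z] ∈ minkowskiSum n) :
    ![-x, y, -z] ∈ minkowskiSum n := by
  rw [mem_minkowskiSum_iff] at h ⊢
  obtain ⟨t, ht, rfl, rfl, rfl⟩ := h
  refine ⟨fun i ↦ -t i, fun i ↦ ⟨neg_le_neg (ht i).2, neg_le.2 (ht i).1⟩, by simp, by simp, ?_⟩
  simp [Odd.neg_pow (by decide : Odd 3)]

lemma minkowskiSum_subset_X {n : ℕ} (hn : 2 ≤ n) {x y z : ℝ} (h : ![x, y, z] ∈ minkowskiSum n) :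
    ![x, y, z] ∈ X n := by
  rw [mem_minkowskiSum_iff] at h
  obtain ⟨t, ht, rfl, rfl, rfl⟩ := h
  exact mem_X_iff.2 (exists_isProfile_ge hn ht)

end TwistedCubic

open TwistedCubic in
theorem mainTheorem1 (n : ℕ) (hn : 3 ≤ n) :
    TwistedCubic.minkowskiSum n = TwistedCubic.X n ∩ TwistedCubic.Y n := by
  have hn2 : 2 ≤ n := by omega
  ext p
  obtain ⟨x, y, z, rfl⟩ : ∃ x y z, p = ![x, y, z] :=
    ⟨p 0, p 1, p 2, by ext i; fin_cases i <;> rfl⟩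
  rw [Set.mem_inter_iff, mem_Y_iff_mem_X]
  refine ⟨fun h ↦ ⟨minkowskiSum_subset_X hn2 h, minkowskiSum_subset_X hn2 (neg_mem_minkowskiSum h)⟩,
    ?_⟩
  rintro ⟨hX, hY⟩
  obtain ⟨z₁, hz₁, hp₁⟩ := mem_X_iff.1 hX
  obtain ⟨z₂, hz₂, hp₂⟩ := mem_X_iff.1 hY
  have h₂ : ![x, y, -z₂] ∈ minkowskiSum n := by
    simpa using neg_mem_minkowskiSum (mem_minkowskiSum_iff.2 hp₂.exists_point)
  obtain ⟨t, ht, rfl, rfl, h₃⟩ := mem_minkowskiSum_iff.1 h₂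
  obtain ⟨t', ht', e1, e2, -, h | ⟨hlt, hp⟩⟩ :=
    exists_point_eq_or_isProfile hn2 ht (z := z) (by linarith)
  · exact mem_minkowskiSum_iff.2 ⟨t', ht', e1, e2, h⟩
  · have := hp.unique hp₁
    linarith
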